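/- Let $R$ be a commutative ring with unity; all modules are unital. A \emph{GV-ideal} of $R$ is a finitely generated ideal $J$ such that the natural map $R\to\operatorname{Hom}_R(J,R)$, $r\mapsto(j\mapsto rj)$, is an isomorphism. For an $R$-module $M$ put $\operatorname{tor}_{GV}(M)=\{x\in M: Jx=0 \text{ for some GV-ideal } J\}$; $M$ is \emph{GV-torsion} if $\operatorname{tor}_{GV}(M)=M$ and \emph{GV-torsion-free} if $\operatorname{tor}_{GV}(M)=0$. A \emph{$w$-module} is a GV-torsion-free module $M$ with $\operatorname{Ext}^1_R(R/J,M)=0$ for every GV-ideal $J$. For a GV-torsion-free module $M$ with injective hull $E(M)$, the \emph{$w$-envelope} is $M_w=\{x\in E(M): Jx\subseteq M\text{ for some GV-ideal } J\}$. A \emph{maximal $w$-ideal} is an ideal that is maximal among the proper ideals of $R$ that are $w$-modules (such ideals are prime). A module $M$ is of \emph{finite type} if there are a finitely generated free module $F$ and a homomorphism $F\to M$ that becomes surjective after localization at every maximal $w$-ideal. For a module $M$ let $L(M)=(M/\operatorname{tor}_{GV}(M))_w$; $M$ is \emph{$w$-projective} if $\operatorname{Ext}^1_R(L(M),N)$ is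 GV-torsion for every torsion-free $w$-module $N$, where $N$ is torsion-free if every non-zero-divisor of $R$ acts injectively on $N$. Let $\mathcal P_w^{\dagger_\infty}$ be the class of GV-torsion-free $R$-modules $N$ such that $\operatorname{Ext}^k_R(M,N)=0$ for all $w$-projective $R$-modules $M$ and all integers $k\ge1$. Finally, let $S_w\subseteq R[x]$ be the multiplicative set of polynomials whose coefficients generate a GV-ideal, let $R\{x\}=R[x]_{S_w}$ be the $w$-Nagata ring, and for an $R$-module $M$ let $M\{x\}=M[x]_{S_w}$, an $R\{x\}$-module. \textbf{Proposition.} Let $M$ be an $R$-module of finite type. The following are equivalent: \begin{enumerate} \item $M$ is a $w$-projective $R$-module; \item $\operatorname{Ext}^1_R(M,B)=0$ for every $B\in\mathcal P_w^{\dagger_\infty}$; \item $\operatorname{Ext}^1_R(M,N)=0$ for every $R\{x\}$-module $N$, regarded as an $R$-module along $R\to R\{x\}$; \item $M\{x\}$ is a projective $R\{x\}$-module. \end{enumerate} -/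

import Mathlib

open CategoryTheory Polynomial

universe u

namespace WTheory

/-! ### Glaz-Vasconcelos ideals -/

section GV

variable {R : Type u} [CommRing R]

/-- `J` is a GV-ideal: it is finitely generated and the natural map `R → Hom_R(J, R)`,
`r ↦ (j ↦ r * j)`, is an isomorphism. -/
def IsGV (J : Ideal R) : Prop :=
  J.FG ∧ Function.Bijective (LinearMap.toSpanSingleton R (J →ₗ[R] R) J.subtype)

theorem IsGV.eq_zero {J : Ideal R} (hJ : IsGV J) {r : R} (h : ∀ j ∈ J, r * j = 0) : r = 0 := by
  apply hJ.2.1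
  ext j
  simpa using h j j.2

theorem IsGV.exists_mul {J : Ideal R} (hJ : IsGV J) (φ : J →ₗ[R] R) :
    ∃ r : R, ∀ j : J, φ j = r * j := by
  obtain ⟨r, hr⟩ := hJ.2.2 φ
  exact ⟨r, fun j => by rw [← hr]; simp⟩

theorem isGV_of {J : Ideal R} (hfg : J.FG) (h0 : ∀ r : R, (∀ j ∈ J, r * j = 0) → r = 0)
    (h1 : ∀ φ : J →ₗ[R] R, ∃ r : R, ∀ j : J, φ j = r * j) : IsGV J := by
  refine ⟨hfg, (injective_iff_map_eq_zero _).2 fun r hr => h0 r fun j hj => ?_, fun φ => ?_⟩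
  · simpa using LinearMap.congr_fun hr ⟨j, hj⟩
  · obtain ⟨r, hr⟩ := h1 φ
    exact ⟨r, by ext j; simp [hr]⟩

theorem isGV_top : IsGV (⊤ : Ideal R) := by
  refine isGV_of ⟨{1}, by simp⟩ (fun r h => by simpa using h 1 trivial) fun φ => ?_
  refine ⟨φ ⟨1, trivial⟩, fun j => ?_⟩
  have : j = (j : R) • (⟨1, trivial⟩ : (⊤ : Ideal R)) := by ext; simp
  conv_lhs => rw [this, map_smul]
  simp [mul_comm]

theorem IsGV.mul {I J : Ideal R} (hI : IsGV I) (hJ : IsGV J) : IsGV (I * J) := by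
  refine isGV_of (hI.1.mul hJ.1) (fun r h => ?_) fun φ => ?_
  · refine hI.eq_zero fun i hi => hJ.eq_zero fun j hj => ?_
    rw [mul_assoc]
    exact h _ (Ideal.mul_mem_mul hi hj)
  · have key : ∀ b : J, ∃ r : R, ∀ a : I,
        φ ⟨a * b, Ideal.mul_mem_mul a.2 b.2⟩ = r * a := fun b =>
      hI.exists_mul
        { toFun := fun a => φ ⟨a * b, Ideal.mul_mem_mul a.2 b.2⟩
          map_add' := fun x y => by rw [← map_add]; congr 1; ext; simp [add_mul]
          map_smul' := fun c x => by
            rw [RingHom.id_apply, ← map_smul]; congr 1; ext; simp [mul_assoc] }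
    choose f hf using key
    obtain ⟨r, hr⟩ := hJ.exists_mul
      { toFun := f
        map_add' := fun x y => by
          rw [← sub_eq_zero]
          refine hI.eq_zero fun a ha => ?_
          have e : φ ⟨a * (x + y : J), Ideal.mul_mem_mul ha (x + y).2⟩ =
              φ ⟨a * x, Ideal.mul_mem_mul ha x.2⟩ + φ ⟨a * y, Ideal.mul_mem_mul ha y.2⟩ := by
            rw [← map_add]; congr 1; ext; simp [mul_add]
          have h1 := hf (x + y) ⟨a, ha⟩
          have h2 := hf x ⟨a, ha⟩
          have h3 := hf y ⟨a, ha⟩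
          simp only at h1 h2 h3
          rw [sub_mul, add_mul, ← h1, ← h2, ← h3, e, sub_self]
        map_smul' := fun c x => by
          rw [RingHom.id_apply, smul_eq_mul, ← sub_eq_zero]
          refine hI.eq_zero fun a ha => ?_
          have e : φ ⟨a * (c • x : J), Ideal.mul_mem_mul ha (c • x).2⟩ =
              c * φ ⟨a * x, Ideal.mul_mem_mul ha x.2⟩ := by
            rw [← smul_eq_mul c, ← map_smul]; congr 1; ext; simp; ring
          have h1 := hf (c • x) ⟨a, ha⟩
          have h2 := hf x ⟨a, ha⟩
          simp only at h1 h2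
          rw [sub_mul, mul_assoc, ← h1, ← h2, e, sub_self] }
    refine ⟨r, fun z => ?_⟩
    obtain ⟨z, hz⟩ := z
    refine Submodule.mul_induction_on' (C := fun z hz => φ ⟨z, hz⟩ = r * z) ?_ ?_ hz
    · intro a ha b hb
      have h1 := hf ⟨b, hb⟩ ⟨a, ha⟩
      have h2 := hr ⟨b, hb⟩
      simp only [LinearMap.coe_mk, AddHom.coe_mk] at h1 h2
      rw [h1, h2]; ring
    · intro x hx y hy h1 h2
      rw [mul_add, ← h1, ← h2, ← map_add]
      rfl

theorem IsGV.mono {J I : Ideal R} (hJ : IsGV J) (hJI : J ≤ I) (hI : I.FG) : IsGV I := by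
  refine isGV_of hI (fun r h => hJ.eq_zero fun j hj => h j (hJI hj)) fun φ => ?_
  obtain ⟨r, hr⟩ := hJ.exists_mul (φ.comp (Submodule.inclusion hJI))
  refine ⟨r, fun i => ?_⟩
  rw [← sub_eq_zero]
  refine hJ.eq_zero fun j hj => ?_
  have h1 := hr ⟨j, hj⟩
  have h2 : φ ((i : R) • Submodule.inclusion hJI ⟨j, hj⟩) = φ (j • i) := by
    congr 1; ext; simp [mul_comm]
  rw [map_smul, map_smul] at h2
  simp only [LinearMap.comp_apply] at h1
  rw [h1] at h2
  simp only [smul_eq_mul] at h2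
  linear_combination -h2

theorem IsGV.pow {J : Ideal R} (hJ : IsGV J) (n : ℕ) : IsGV (J ^ n) := by
  induction n with
  | zero => simpa using isGV_top
  | succ n ih => rw [pow_succ]; exact ih.mul hJ

end GV

/-! ### GV-torsion, `Ext`, w-modules -/

section Modules

variable (R : Type u) [CommRing R]

/-- The submodule `tor_GV(M)` of elements annihilated by some GV-ideal. -/
def torGV (M : Type*) [AddCommGroup M] [Module R M] : Submodule R M where
  carrier := {x | ∃ J : Ideal R, IsGV J ∧ ∀ j ∈ J, j • x = 0}
  zero_mem' := ⟨⊤, isGV_top, fun j _ => smul_zero j⟩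
  add_mem' := by
    rintro x y ⟨I, hI, hx⟩ ⟨J, hJ, hy⟩
    refine ⟨I * J, hI.mul hJ, fun j hj => ?_⟩
    rw [smul_add, hx j (Ideal.mul_le_left hj), hy j (Ideal.mul_le_right hj), add_zero]
  smul_mem' := by
    rintro c x ⟨J, hJ, hx⟩
    exact ⟨J, hJ, fun j hj => by rw [smul_comm, hx j hj, smul_zero]⟩

def IsGVTorsion (M : Type*) [AddCommGroup M] [Module R M] : Prop := torGV R M = ⊤

def IsGVTorsionFree (M : Type*) [AddCommGroup M] [Module R M] : Prop := torGV R M = ⊥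

/-- `Ext_R^k(M, N)`; it carries Mathlib's `R`-module structure. -/
abbrev ExtR (M N : Type u) [AddCommGroup M] [Module R M] [AddCommGroup N] [Module R N]
    (k : ℕ) : Type u :=
  Abelian.Ext.{u} (ModuleCat.of R M) (ModuleCat.of R N) k

/-- A w-module: GV-torsion-free with `Ext_R^1(R/J, M) = 0` for all GV-ideals `J`. -/
def IsWModule (M : Type u) [AddCommGroup M] [Module R M] : Prop :=
  IsGVTorsionFree R M ∧ ∀ J : Ideal R, IsGV J → Subsingleton (ExtR R (R ⧸ J) M 1)

/-- A maximal w-ideal: maximal among the proper ideals that are w-modules. -/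
def IsMaximalWIdeal (m : Ideal R) : Prop :=
  Maximal (fun I : Ideal R => I ≠ ⊤ ∧ IsWModule R I) m

variable {R}

theorem subsingleton_ext_quotient_iff (J : Ideal R) (M : Type u) [AddCommGroup M] [Module R M] :
    Subsingleton (ExtR R (R ⧸ J) M 1) ↔
      ∀ φ : J →ₗ[R] M, ∃ x : M, ∀ j : J, φ j = (j : R) • x := by
  let S : ShortComplex (ModuleCat.{u} R) :=
    { f := ModuleCat.ofHom J.subtype
      g := ModuleCat.ofHom J.mkQ
      zero := by ext x; exact (Submodule.Quotient.mk_eq_zero J).2 x.2 }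
  have hS : S.ShortExact :=
    { exact := (ShortComplex.ShortExact.moduleCat_exact_iff_function_exact _).mpr
        fun x => (Submodule.Quotient.mk_eq_zero J).trans
          ⟨fun h => ⟨⟨x, h⟩, rfl⟩, fun ⟨y, hy⟩ => hy ▸ y.2⟩
      mono_f := (ModuleCat.mono_iff_injective _).mpr J.injective_subtype
      epi_g := (ModuleCat.epi_iff_surjective _).mpr J.mkQ_surjective }
  have : Projective S.X₂ := ModuleCat.projective_of_free (Module.Basis.singleton PUnit.{u + 1} R)
  constructor
  · intro h φ
    obtain ⟨y, hy⟩ := Abelian.Ext.contravariant_sequence_exact₁ hS _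
      (Abelian.Ext.mk₀ (ModuleCat.ofHom φ : S.X₁ ⟶ ModuleCat.of R M)) (n₁ := 1) rfl
      (h.elim _ _)
    obtain ⟨ψ, rfl⟩ := (Abelian.Ext.mk₀_bijective _ _).2 y
    rw [Abelian.Ext.mk₀_comp_mk₀] at hy
    have e := (Abelian.Ext.mk₀_bijective _ _).1 hy
    refine ⟨ψ.hom (1 : R), fun j => ?_⟩
    have e' := LinearMap.congr_fun (congrArg ModuleCat.Hom.hom e) j
    rw [← map_smul]
    refine Eq.trans e'.symm ?_
    simp [S]
  · intro h
    refine subsingleton_of_forall_eq 0 fun e => ?_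
    obtain ⟨y, rfl⟩ := Abelian.Ext.contravariant_sequence_exact₃ hS _ (n₁ := 1) e
      (Abelian.Ext.eq_zero_of_projective (P := S.X₂) _) (n₀ := 0) rfl
    obtain ⟨φ, rfl⟩ := (Abelian.Ext.mk₀_bijective _ _).2 y
    obtain ⟨x, hx⟩ := h φ.hom
    have : φ = S.f ≫ ModuleCat.ofHom (LinearMap.toSpanSingleton R M x) := by
      ext j
      simpa [S] using hx j
    rw [this, ← Abelian.Ext.mk₀_comp_mk₀, hS.extClass_comp_assoc]

theorem isWModule_ideal_iff (I : Ideal R) :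
    IsWModule R I ↔ ∀ J : Ideal R, IsGV J → ∀ x : R, (∀ j ∈ J, j * x ∈ I) → x ∈ I := by
  constructor
  · intro h J hJ x hx
    obtain ⟨y, hy⟩ := (subsingleton_ext_quotient_iff J I).1 (h.2 J hJ)
      { toFun := fun j => ⟨j * x, hx j j.2⟩
        map_add' := fun a b => by ext; simp [add_mul]
        map_smul' := fun c a => by ext; simp [mul_assoc] }
    have : x - y = 0 := hJ.eq_zero fun j hj => by
      have := congrArg Subtype.val (hy ⟨j, hj⟩)
      simp only [LinearMap.coe_mk, AddHom.coe_mk, SetLike.val_smul, smul_eq_mul] at this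
      linear_combination this
    rw [sub_eq_zero.1 this]
    exact y.2
  · intro h
    refine ⟨?_, fun J hJ => (subsingleton_ext_quotient_iff J I).2 fun φ => ?_⟩
    · refine (Submodule.eq_bot_iff _).2 ?_
      rintro ⟨x, hx⟩ ⟨J, hJ, h0⟩
      ext
      refine hJ.eq_zero fun j hj => ?_
      have := congrArg Subtype.val (h0 j hj)
      simpa [mul_comm] using this
    · obtain ⟨r, hr⟩ := hJ.exists_mul (I.subtype.comp φ)
      refine ⟨⟨r, h J hJ r fun j hj => ?_⟩, fun j => ?_⟩
      · have := hr ⟨j, hj⟩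
        simp only [LinearMap.comp_apply, Submodule.subtype_apply] at this
        rw [mul_comm, ← this]
        exact (φ ⟨j, hj⟩).2
      · ext
        have := hr j
        simp only [LinearMap.comp_apply, Submodule.subtype_apply] at this
        rw [this]
        simp [mul_comm]

theorem IsMaximalWIdeal.isPrime {m : Ideal R} (hm : IsMaximalWIdeal R m) : m.IsPrime := by
  refine ⟨hm.prop.1, fun {a b} hab => or_iff_not_imp_left.2 fun ha => ?_⟩
  have hw := (isWModule_ideal_iff m).1 hm.prop.2
  let I : Ideal R := Submodule.comap (LinearMap.mulRight R a) m
  have hmem : ∀ x, x ∈ I ↔ x * a ∈ m := fun x => Iff.rfl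
  have hmI : m ≤ I := fun x hx => (hmem x).2 (m.mul_mem_right a hx)
  have hI : I ≠ ⊤ ∧ IsWModule R I := by
    refine ⟨fun h => ha ?_, (isWModule_ideal_iff I).2 fun J hJ x hx => ?_⟩
    · simpa using (hmem 1).1 (h ▸ trivial)
    · exact (hmem x).2 (hw J hJ _ fun j hj => by simpa [mul_assoc] using (hmem _).1 (hx j hj))
  exact hm.le_of_ge hI hmI ((hmem b).2 (by rwa [mul_comm]))

variable (R)

/-- A w-epimorphism: surjective after localizing at every maximal w-ideal. -/
def IsWEpi {M N : Type*} [AddCommGroup M] [Module R M] [AddCommGroup N] [Module R N]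
    (f : M →ₗ[R] N) : Prop :=
  ∀ (m : Ideal R) (hm : IsMaximalWIdeal R m),
    haveI : m.IsPrime := hm.isPrime
    Function.Surjective (LocalizedModule.map m.primeCompl f)

/-- Finite type: there is a w-epimorphism from a finitely generated free module. -/
def IsFiniteType (M : Type*) [AddCommGroup M] [Module R M] : Prop :=
  ∃ (n : ℕ) (g : (Fin n → R) →ₗ[R] M), IsWEpi R g

/-! ### Injective hulls and w-envelopes -/

/-- `i : M → E` is an injective hull: `E` is injective, and `i` is an essential monomorphism. -/
structure IsInjectiveHull {M E : Type u} [AddCommGroup M] [Module R M]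
    [AddCommGroup E] [Module R E] (i : M →ₗ[R] E) : Prop where
  injective : Module.Injective R E
  mono : Function.Injective i
  essential : ∀ K : Submodule R E, K ⊓ LinearMap.range i = ⊥ → K = ⊥

theorem exists_injectiveHull (M : Type u) [AddCommGroup M] [Module R M] :
    ∃ (E : ModuleCat.{u} R) (i : M →ₗ[R] E), IsInjectiveHull R i := by
  let E₀ : ModuleCat.{u} R := Injective.under (ModuleCat.of R M)
  let i₀ : M →ₗ[R] E₀ := (Injective.ι (ModuleCat.of R M)).hom
  have hi₀ : Function.Injective i₀ := (ModuleCat.mono_iff_injective _).1 inferInstance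
  have hE₀ : Module.Injective R E₀ :=
    (Module.injective_iff_injective_object R E₀).2 (Injective.injective_under _)
  let P : Submodule R E₀ := LinearMap.range i₀
  let S : Set (Submodule R E₀) :=
    {H | P ≤ H ∧ ∀ x ∈ H, x ≠ 0 → ∃ r : R, r • x ∈ P ∧ r • x ≠ 0}
  obtain ⟨H, hPH, hH⟩ := zorn_le_nonempty₀ S (fun c hcS hc y hy => by
    refine ⟨sSup c, ⟨(hcS hy).1.trans (le_sSup hy), fun x hx hx0 => ?_⟩,
      fun z hz => le_sSup hz⟩
    obtain ⟨K, hK, hxK⟩ := (Submodule.mem_sSup_of_directed ⟨y, hy⟩ hc.directedOn).1 hx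
    exact (hcS hK).2 x hxK hx0) P
    ⟨le_rfl, fun x hx hx0 => ⟨1, by simpa using hx, by simpa using hx0⟩⟩
  obtain ⟨N, -, hN⟩ := zorn_le_nonempty₀ {N : Submodule R E₀ | ∀ x ∈ N, x ∈ H → x = 0}
    (fun c hcS hc y hy => by
      refine ⟨sSup c, fun x hx hxH => ?_, fun z hz => le_sSup hz⟩
      obtain ⟨K, hK, hxK⟩ := (Submodule.mem_sSup_of_directed ⟨y, hy⟩ hc.directedOn).1 hx
      exact hcS hK x hxK hxH) ⊥ (fun x hx _ => by simpa using hx)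
  obtain ⟨h, hh⟩ := hE₀.out (N.mkQ.comp H.subtype) (by
    refine (injective_iff_map_eq_zero _).2 fun x hx => ?_
    have : (x : E₀) ∈ N := by simpa using hx
    ext
    exact hN.prop _ this x.2) H.subtype
  let g : E₀ →ₗ[R] E₀ := h.comp N.mkQ
  have hgH : ∀ x ∈ H, g x = x := fun x hx => hh ⟨x, hx⟩
  have hgN : ∀ x, g x = 0 → x ∈ N := by
    intro x hx
    refine hN.le_of_ge (y := LinearMap.ker g) (fun y hy hyH => ?_) (fun y hy => ?_) hx
    · rw [← hgH y hyH]; exact hy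
    · have : N.mkQ y = 0 := by simpa using hy
      simp [g, this]
  have hgN' : ∀ x ∈ N, g x = 0 := by
    intro x hx
    have : N.mkQ x = 0 := by simpa using hx
    simp [g, this]
  have hHr : H ≤ LinearMap.range g := fun x hx => ⟨x, hgH x hx⟩
  have hrS : LinearMap.range g ∈ S := by
    refine ⟨hPH.trans hHr, ?_⟩
    rintro _ ⟨x, rfl⟩ hx0
    have hxN : x ∉ N := fun hx => hx0 (hgN' x hx)
    obtain ⟨z, hz, hzH, hz0⟩ : ∃ z ∈ N ⊔ Submodule.span R {x}, z ∈ H ∧ z ≠ 0 := by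
      by_contra! hcon
      exact hxN (hN.le_of_ge hcon le_sup_left
        (Submodule.mem_sup_right (Submodule.mem_span_singleton_self x)))
    obtain ⟨n, hn, w, hw, rfl⟩ := Submodule.mem_sup.1 hz
    obtain ⟨r, rfl⟩ := Submodule.mem_span_singleton.1 hw
    have e : r • g x = n + r • x := by
      rw [← hgH _ hzH, map_add, hgN' n hn, zero_add, map_smul]
    obtain ⟨s, hs, hs0⟩ := hH.prop.2 _ hzH hz0
    exact ⟨s * r, by rwa [mul_smul, e], by rwa [mul_smul, e]⟩
  have hr : ∀ x, g x ∈ H := fun x => hH.le_of_ge hrS hHr ⟨x, rfl⟩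
  refine ⟨ModuleCat.of R H, i₀.codRestrict H fun x => hPH ⟨x, rfl⟩, ⟨fun X Y _ _ _ _ f hf u => ?_⟩,
    fun x y hxy => hi₀ (congrArg Subtype.val hxy), fun K hK => ?_⟩
  · obtain ⟨v, hv⟩ := hE₀.out f hf (H.subtype.comp u)
    refine ⟨(g.codRestrict H hr).comp v, fun x => ?_⟩
    ext
    simp only [LinearMap.comp_apply, LinearMap.codRestrict_apply, hv]
    exact hgH _ (u x).2
  · refine (Submodule.eq_bot_iff _).2 fun x hx => ?_
    by_contra hx0
    obtain ⟨r, ⟨y, hy⟩, hr0⟩ := hH.prop.2 x x.2 fun h0 => hx0 (Subtype.ext h0)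
    have : r • x ∈ K ⊓ LinearMap.range (i₀.codRestrict H fun x => hPH ⟨x, rfl⟩) :=
      ⟨K.smul_mem r hx, y, Subtype.ext hy⟩
    rw [hK] at this
    exact hr0 (congrArg Subtype.val ((Submodule.mem_bot R).1 this))

/-- The injective hull `E(M)`. -/
noncomputable def injectiveHull (M : Type u) [AddCommGroup M] [Module R M] : ModuleCat.{u} R :=
  (exists_injectiveHull R M).choose

/-- The embedding `M → E(M)`. -/
noncomputable def toInjectiveHull (M : Type u) [AddCommGroup M] [Module R M] :
    M →ₗ[R] injectiveHull R M :=
  (exists_injectiveHull R M).choose_spec.choose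

theorem isInjectiveHull_toInjectiveHull (M : Type u) [AddCommGroup M] [Module R M] :
    IsInjectiveHull R (toInjectiveHull R M) :=
  (exists_injectiveHull R M).choose_spec.choose_spec

/-- The w-envelope `M_w = {x ∈ E(M) | J x ⊆ M for some GV-ideal J}` (of a GV-torsion-free `M`). -/
def wEnvelope (M : Type u) [AddCommGroup M] [Module R M] : Submodule R (injectiveHull R M) where
  carrier := {x | ∃ J : Ideal R, IsGV J ∧ ∀ j ∈ J, j • x ∈ LinearMap.range (toInjectiveHull R M)}
  zero_mem' := ⟨⊤, isGV_top, fun j _ => by rw [smul_zero]; exact zero_mem _⟩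
  add_mem' := by
    rintro x y ⟨I, hI, hx⟩ ⟨J, hJ, hy⟩
    refine ⟨I * J, hI.mul hJ, fun j hj => ?_⟩
    rw [smul_add]
    exact add_mem (hx j (Ideal.mul_le_left hj)) (hy j (Ideal.mul_le_right hj))
  smul_mem' := by
    rintro c x ⟨J, hJ, hx⟩
    exact ⟨J, hJ, fun j hj => by rw [smul_comm]; exact Submodule.smul_mem _ c (hx j hj)⟩

/-! ### w-projective modules and the class `P_w^{†∞}` -/

/-- `L(M) = (M / tor_GV(M))_w`. -/
abbrev LMod (M : Type u) [AddCommGroup M] [Module R M] : Type u :=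
  ↥(wEnvelope R (M ⧸ torGV R M))

/-- `M` is w-projective: `Ext_R^1(L(M), N)` is GV-torsion for every torsion-free w-module `N`.
Torsion-free means that the regular elements of `R` (the non-zero-divisors) act injectively. -/
def IsWProjective (M : Type u) [AddCommGroup M] [Module R M] : Prop :=
  ∀ (N : Type u) [AddCommGroup N] [Module R N],
    Module.IsTorsionFree R N → IsWModule R N → IsGVTorsion R (ExtR R (LMod R M) N 1)

/-- The class `P_w^{†∞}`: GV-torsion-free `N` such that `Ext_R^k(M, N) = 0` for all w-projective
`M` and all `k ≥ 1`. -/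
def IsPwDagger (N : Type u) [AddCommGroup N] [Module R N] : Prop :=
  IsGVTorsionFree R N ∧
    ∀ (M : Type u) [AddCommGroup M] [Module R M], IsWProjective R M →
      ∀ k : ℕ, 1 ≤ k → Subsingleton (ExtR R M N k)

/-! ### The w-Nagata ring and the w-Nagata module -/

/-- The multiplicative set `S_w` of polynomials whose content ideal is a GV-ideal. -/
def nagataSet : Submonoid R[X] where
  carrier := {f | IsGV f.contentIdeal}
  one_mem' := by
    change IsGV (1 : R[X]).contentIdeal
    rw [contentIdeal_one]
    exact isGV_top
  mul_mem' := by
    intro f g hf hg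
    have h := hf.mul hg
    obtain ⟨n, hn⟩ := Ideal.exists_pow_le_of_le_radical_of_fg
      (mul_contentIdeal_le_radical_contentIdeal_mul (p := f) (q := g)) h.1
    exact (h.pow n).mono hn (contentIdeal_FG _)

/-- The w-Nagata ring `R{x} = R[x]_{S_w}`. -/
abbrev WNagata : Type u := Localization (nagataSet R)

/-- The w-Nagata module `M{x} = M[x]_{S_w}`, a module over `R{x}`. -/
abbrev WNagataModule (M : Type u) [AddCommGroup M] [Module R M] : Type u :=
  LocalizedModule (nagataSet R) (PolynomialModule R M)

end Modules

end WTheory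

/-! Base change to `R{x}` turns every GV-ideal `J` into the unit ideal: `J` is the content of some
`f ∈ S_w`, which lies in `J R[x]` and becomes a unit. As `R{x}` is flat over `R`, GV-torsion kernels
and cokernels disappear, so `M` and `L(M)` have the same base change, and `M{x} ≅ R{x} ⊗ M`.

If `M` is w-projective, test it on the kernel of a free cover of `L(M)`. A GV-ideal kills the class
of this extension, so each of its elements, acting on `L(M)`, lifts to the cover; over `R{x}` these
elements generate `1`, the identity lifts, and `R{x} ⊗ M` is projective
(`IsWProjective.projective_tensor`). By adjunction and dimension shifting, `Ext_R^k(M, N) = 0` for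
all `R{x}`-modules `N` and `k ≥ 1`. Hence `R{x}`-modules lie in `P_w^{†∞}`, which gives (2) → (3).
Testing (3) on the base changed syzygy splits the base changed presentation, which gives (4).

Finite type is needed only for (4) → (1). A section of `R{x}^n → R{x} ⊗ M` is a finite matrix; after
clearing denominators, comparing coefficients of powers of `x` gives endomorphisms of `R^n`. Through
these, multiplication on `L(M)` by each coefficient of a polynomial in `S_w` factors over `R^n`. The
GV-ideal of coefficients therefore kills `Ext¹(L(M), N)`. -/

namespace WTheory

/-! ### GV-ideals, GV-torsion and w-modules. -/

section GVBasics

variable {R : Type u} [CommRing R]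

theorem IsGV.prod {ι : Type*} (s : Finset ι) {I : ι → Ideal R} (h : ∀ i ∈ s, IsGV (I i)) :
    IsGV (∏ i ∈ s, I i) :=
  Finset.prod_induction I IsGV (fun _ _ => IsGV.mul) (by simpa using isGV_top) h

/-- The GV-closure of a submodule is idempotent. -/
theorem IsGV.exists_smul_mem {J : Ideal R} (hJ : IsGV J) {X : Type*} [AddCommGroup X] [Module R X]
    (N : Submodule R X) (x : X)
    (h : ∀ j ∈ J, ∃ I : Ideal R, IsGV I ∧ ∀ i ∈ I, i • j • x ∈ N) :
    ∃ I : Ideal R, IsGV I ∧ ∀ i ∈ I, i • x ∈ N := by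
  obtain ⟨n, a, ha⟩ := Submodule.fg_iff_exists_fin_generating_family.1 hJ.1
  have haJ : ∀ k, a k ∈ J := fun k => ha ▸ Submodule.subset_span ⟨k, rfl⟩
  choose I hI hIa using fun k => h (a k) (haJ k)
  -- `J` has finitely many generators `a k`, so the product of the GV-ideals chosen for them serves
  -- all of `J` at once.
  refine ⟨(∏ k, I k) * J, (IsGV.prod _ fun k _ => hI k).mul hJ, fun i hi => ?_⟩
  have key : ∀ i ∈ ∏ k, I k, ∀ j ∈ J, i • j • x ∈ N := by
    intro i hi j hj
    rw [← ha] at hj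
    induction hj using Submodule.span_induction with
    | mem y hy =>
      obtain ⟨k, rfl⟩ := hy
      exact hIa k i (Ideal.prod_le_inf.trans (Finset.inf_le (Finset.mem_univ k)) hi)
    | zero => simp
    | add y z _ _ hy hz => rw [add_smul, smul_add]; exact add_mem hy hz
    | smul c y _ hy =>
      rw [smul_assoc, smul_comm i c]
      exact N.smul_mem c hy
  refine Submodule.mul_induction_on hi (fun a ha b hb => ?_) fun a b ha hb => ?_
  · rw [mul_smul]; exact key a ha b hb
  · rw [add_smul]; exact add_mem ha hb

theorem IsGVTorsionFree.eq_zero {M : Type*} [AddCommGroup M] [Module R M]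
    (hM : IsGVTorsionFree R M) {J : Ideal R} (hJ : IsGV J) {x : M} (h : ∀ j ∈ J, j • x = 0) :
    x = 0 := by
  have : x ∈ torGV R M := ⟨J, hJ, h⟩
  rwa [hM, Submodule.mem_bot] at this

theorem isGVTorsionFree_of {M : Type*} [AddCommGroup M] [Module R M]
    (h : ∀ (J : Ideal R) (x : M), IsGV J → (∀ j ∈ J, j • x = 0) → x = 0) :
    IsGVTorsionFree R M :=
  (Submodule.eq_bot_iff _).2 fun x ⟨J, hJ, hx⟩ => h J x hJ hx

theorem IsGVTorsionFree.of_injective {M N : Type*} [AddCommGroup M] [Module R M]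
    [AddCommGroup N] [Module R N] (hN : IsGVTorsionFree R N) {f : M →ₗ[R] N}
    (hf : Function.Injective f) : IsGVTorsionFree R M :=
  isGVTorsionFree_of fun J x hJ hx => hf <| by
    rw [map_zero]
    exact hN.eq_zero hJ fun j hj => by rw [← map_smul, hx j hj, map_zero]

theorem isGVTorsionFree_quotient_torGV (M : Type*) [AddCommGroup M] [Module R M] :
    IsGVTorsionFree R (M ⧸ torGV R M) := by
  refine isGVTorsionFree_of fun J x hJ hx => ?_
  obtain ⟨x, rfl⟩ := Submodule.Quotient.mk_surjective _ x
  refine (Submodule.Quotient.mk_eq_zero _).2 ?_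
  obtain ⟨I, hI, h⟩ := hJ.exists_smul_mem ⊥ x fun j hj => by
    have := hx j hj
    rw [← Submodule.Quotient.mk_smul, Submodule.Quotient.mk_eq_zero] at this
    obtain ⟨I, hI, h⟩ := this
    exact ⟨I, hI, fun i hi => by simpa using h i hi⟩
  exact ⟨I, hI, fun i hi => by simpa using h i hi⟩

/-- The GV-torsion of `E` meets the image of `M` trivially, so it vanishes by essentiality. -/
theorem IsInjectiveHull.isGVTorsionFree {M E : Type u} [AddCommGroup M] [Module R M]
    [AddCommGroup E] [Module R E] {i : M →ₗ[R] E} (hi : IsInjectiveHull R i)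
    (hM : IsGVTorsionFree R M) : IsGVTorsionFree R E := by
  refine hi.essential _ ((Submodule.eq_bot_iff _).2 ?_)
  rintro _ ⟨⟨J, hJ, hx⟩, y, rfl⟩
  rw [hM.eq_zero (x := y) hJ fun j hj => hi.mono (by rw [map_smul, hx j hj, map_zero]), map_zero]

/-- A polynomial with prescribed finitely generated content ideal. -/
theorem exists_contentIdeal_eq {J : Ideal R} (hJ : J.FG) : ∃ f : R[X], f.contentIdeal = J := by
  obtain ⟨n, a, ha⟩ := Submodule.fg_iff_exists_fin_generating_family.1 hJ
  have hc : ∀ k, (∑ i : Fin n, monomial i (a i)).coeff k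
      = ∑ i : Fin n, if (i : ℕ) = k then a i else 0 := fun k => by
    simp [coeff_monomial]
  refine ⟨∑ i : Fin n, monomial i (a i), le_antisymm ?_ ?_⟩
  · rw [contentIdeal_def, Ideal.span_le]
    intro c hcm
    obtain ⟨k, -, rfl⟩ := mem_coeffs_iff.1 hcm
    rw [hc, ← ha]
    refine Submodule.sum_mem _ fun i _ => ?_
    split_ifs
    · exact Submodule.subset_span ⟨i, rfl⟩
    · exact zero_mem _
  · rw [← ha]
    refine Submodule.span_le.2 ?_
    rintro _ ⟨k, rfl⟩
    have := coeff_mem_contentIdeal (∑ i : Fin n, monomial i (a i)) (k : ℕ)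
    rw [hc] at this
    simpa [Fin.val_inj] using this

/-- An ideal contained in no maximal w-ideal contains a GV-ideal. -/
theorem exists_isGV_le {A : Ideal R} (hA : ∀ m, IsMaximalWIdeal R m → ¬ A ≤ m) :
    ∃ J : Ideal R, IsGV J ∧ J ≤ A := by
  -- `W` is the GV-closure of `A`, an ideal that is a w-module. If it is proper, Zorn's lemma puts a
  -- maximal w-ideal above it, hence above `A`.
  let W : Ideal R :=
    { carrier := {x | ∃ J : Ideal R, IsGV J ∧ ∀ j ∈ J, j * x ∈ A}
      zero_mem' := ⟨⊤, isGV_top, fun j _ => by simp⟩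
      add_mem' := by
        rintro x y ⟨I, hI, hx⟩ ⟨J, hJ, hy⟩
        refine ⟨I * J, hI.mul hJ, fun j hj => ?_⟩
        rw [mul_add]
        exact add_mem (hx j (Ideal.mul_le_left hj)) (hy j (Ideal.mul_le_right hj))
      smul_mem' := by
        rintro c x ⟨J, hJ, hx⟩
        exact ⟨J, hJ, fun j hj => by
          rw [smul_eq_mul, mul_left_comm]; exact A.mul_mem_left c (hx j hj)⟩ }
  have hAW : A ≤ W := fun x hx => ⟨⊤, isGV_top, fun j _ => A.mul_mem_left j hx⟩
  have hW : IsWModule R W :=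
    (isWModule_ideal_iff W).2 fun J hJ x hx => hJ.exists_smul_mem A x fun j hj => hx j hj
  by_cases htop : W = ⊤
  · obtain ⟨J, hJ, h⟩ : (1 : R) ∈ W := htop ▸ trivial
    exact ⟨J, hJ, fun j hj => by simpa using h j hj⟩
  · obtain ⟨m, hWm, hm⟩ := zorn_le_nonempty₀ {I : Ideal R | I ≠ ⊤ ∧ IsWModule R I}
      (fun c hcS hc y hy => by
        refine ⟨sSup c, ⟨fun h => ?_, (isWModule_ideal_iff _).2 fun J hJ x hx => ?_⟩,
          fun z hz => le_sSup hz⟩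
        · obtain ⟨K, hK, h1⟩ := (Submodule.mem_sSup_of_directed ⟨y, hy⟩ hc.directedOn).1
            (h.symm ▸ Submodule.mem_top : (1 : R) ∈ sSup c)
          exact (hcS hK).1 ((Ideal.eq_top_iff_one K).2 h1)
        -- As `J` is finitely generated, `J x` already lies in a single member of the chain.
        · obtain ⟨n, a, ha⟩ := Submodule.fg_iff_exists_fin_generating_family.1 hJ.1
          have haJ : ∀ k, a k ∈ J := fun k => ha ▸ Submodule.subset_span ⟨k, rfl⟩
          choose K hK hKa using fun k =>
            (Submodule.mem_sSup_of_directed ⟨y, hy⟩ hc.directedOn).1 (hx (a k) (haJ k))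
          have : Nonempty c := ⟨⟨y, hy⟩⟩
          have hd : IsDirectedOrder c := hc.directedOn.isDirectedOrder
          obtain ⟨L, hL⟩ := Finite.exists_le (fun k => (⟨K k, hK k⟩ : c))
          refine Submodule.mem_sSup_of_mem L.2
            ((isWModule_ideal_iff _).1 (hcS L.2).2 J hJ x fun j hj => ?_)
          have : J ≤ Submodule.comap (LinearMap.mulRight R x) L := by
            rw [← ha]
            refine Submodule.span_le.2 ?_
            rintro _ ⟨k, rfl⟩
            exact hL k (hKa k)
          exact this hj)
      W ⟨htop, hW⟩
    exact absurd (hAW.trans hWm) (hA m hm)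

/-- The cokernel of a w-epimorphism is GV-torsion. -/
theorem IsWEpi.exists_isGV {M N : Type*} [AddCommGroup M] [Module R M] [AddCommGroup N]
    [Module R N] {f : M →ₗ[R] N} (hf : IsWEpi R f) (y : N) :
    ∃ J : Ideal R, IsGV J ∧ ∀ j ∈ J, j • y ∈ LinearMap.range f := by
  -- The ideal of all `r` with `r • y` in the range of `f` lies in no maximal w-ideal `m`:
  -- surjectivity at `m` produces an element of it outside `m`.
  obtain ⟨J, hJ, h⟩ := exists_isGV_le
    (A := Submodule.comap (LinearMap.toSpanSingleton R N y) (LinearMap.range f)) fun m hm hle => by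
      have := hm.isPrime
      obtain ⟨z, hz⟩ := hf m hm (LocalizedModule.mk y 1)
      induction z using LocalizedModule.induction_on with
      | h x s =>
        rw [LocalizedModule.map_mk, LocalizedModule.mk_eq] at hz
        obtain ⟨c, hc⟩ := hz
        refine (c * s).2 (hle ⟨(c : R) • x, ?_⟩)
        simpa [Submonoid.smul_def, mul_smul] using hc
  exact ⟨J, hJ, fun j hj => h hj⟩

/-! ### The map to `L(M)` -/

variable (R) in
/-- The natural map `M → L(M)`. -/
noncomputable def toLMod (M : Type u) [AddCommGroup M] [Module R M] : M →ₗ[R] LMod R M :=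
  ((toInjectiveHull R (M ⧸ torGV R M)).codRestrict (wEnvelope R _)
    fun x => show _ ∈ wEnvelope R _ from ⟨⊤, isGV_top, fun j _ => ⟨j • x, map_smul _ _ _⟩⟩).comp (torGV R M).mkQ

theorem toLMod_eq_zero_iff {M : Type u} [AddCommGroup M] [Module R M] (x : M) :
    toLMod R M x = 0 ↔ x ∈ torGV R M := by
  rw [← Submodule.Quotient.mk_eq_zero, Subtype.ext_iff]
  exact map_eq_zero_iff _ (isInjectiveHull_toInjectiveHull R (M ⧸ torGV R M)).mono

theorem exists_smul_mem_range_toLMod {M : Type u} [AddCommGroup M] [Module R M] (y : LMod R M) :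
    ∃ J : Ideal R, IsGV J ∧ ∀ j ∈ J, j • y ∈ LinearMap.range (toLMod R M) := by
  obtain ⟨J, hJ, h⟩ := y.2
  refine ⟨J, hJ, fun j hj => ?_⟩
  obtain ⟨x, hx⟩ := h j hj
  obtain ⟨x, rfl⟩ := Submodule.Quotient.mk_surjective _ x
  exact ⟨x, Subtype.ext hx⟩

theorem isGVTorsionFree_LMod (M : Type u) [AddCommGroup M] [Module R M] :
    IsGVTorsionFree R (LMod R M) :=
  ((isInjectiveHull_toInjectiveHull R (M ⧸ torGV R M)).isGVTorsionFree
    (isGVTorsionFree_quotient_torGV M)).of_injective (Submodule.injective_subtype _)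

/-! ### w-modules -/

theorem isWModule_iff {M : Type u} [AddCommGroup M] [Module R M] :
    IsWModule R M ↔ IsGVTorsionFree R M ∧ ∀ J : Ideal R, IsGV J →
      ∀ φ : J →ₗ[R] M, ∃ x : M, ∀ j : J, φ j = (j : R) • x := by
  simp only [IsWModule, subsingleton_ext_quotient_iff]

theorem isGVTorsionFree_finsupp (ι : Type*) : IsGVTorsionFree R (ι →₀ R) :=
  isGVTorsionFree_of fun J x hJ hx => Finsupp.ext fun i => hJ.eq_zero fun j hj => by
    simpa [mul_comm] using DFunLike.congr_fun (hx j hj) i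

/-- Free modules are w-modules. -/
theorem isWModule_finsupp (ι : Type u) : IsWModule R (ι →₀ R) := by
  classical
  refine isWModule_iff.2 ⟨isGVTorsionFree_finsupp ι, fun J hJ φ => ?_⟩
  obtain ⟨n, a, ha⟩ := Submodule.fg_iff_exists_fin_generating_family.1 hJ.1
  have haJ : ∀ k, a k ∈ J := fun k => ha ▸ Submodule.subset_span ⟨k, rfl⟩
  choose r hr using fun i => hJ.exists_mul ((Finsupp.lapply i).comp φ)
  -- The coordinates `r i` have finite support: `r i` vanishes as soon as the `i`-th coordinates of
  -- all the `φ (a k)` do.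
  let s : Finset ι := Finset.univ.biUnion fun k => (φ ⟨a k, haJ k⟩).support
  have hs : ∀ i, r i ≠ 0 → i ∈ s := by
    intro i hi
    by_contra his
    refine hi (hJ.eq_zero fun j hj => ?_)
    rw [← ha] at hj
    induction hj using Submodule.span_induction with
    | mem y hy =>
      obtain ⟨k, rfl⟩ := hy
      have h1 := hr i ⟨a k, haJ k⟩
      rw [← h1]
      by_contra h0
      exact his (Finset.mem_biUnion.2 ⟨k, Finset.mem_univ _, Finsupp.mem_support_iff.2 h0⟩)
    | zero => simp
    | add y z _ _ hy hz => rw [mul_add, hy, hz, add_zero]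
    | smul c y _ hy => rw [smul_eq_mul, mul_left_comm, hy, mul_zero]
  refine ⟨Finsupp.onFinset s r hs, fun j => Finsupp.ext fun i => ?_⟩
  have := hr i j
  simpa [mul_comm] using this

theorem isWModule_fin (n : ℕ) : IsWModule R (Fin n → R) := by
  refine isWModule_iff.2 ⟨isGVTorsionFree_of fun J x hJ hx => funext fun i =>
    hJ.eq_zero fun j hj => by simpa [mul_comm] using congrFun (hx j hj) i, fun J hJ φ => ?_⟩
  choose r hr using fun i => hJ.exists_mul ((LinearMap.proj i).comp φ)
  exact ⟨r, fun j => funext fun i => by simpa [mul_comm] using hr i j⟩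

/-- The kernel of a map from a w-module to a GV-torsion-free module is a w-module. -/
theorem IsWModule.ker {F M : Type u} [AddCommGroup F] [Module R F] [AddCommGroup M] [Module R M]
    (hF : IsWModule R F) (hM : IsGVTorsionFree R M) (f : F →ₗ[R] M) :
    IsWModule R (LinearMap.ker f) := by
  refine isWModule_iff.2 ⟨hF.1.of_injective (Submodule.injective_subtype _), fun J hJ φ => ?_⟩
  obtain ⟨x, hx⟩ := (isWModule_iff.1 hF).2 J hJ ((Submodule.subtype _).comp φ)
  refine ⟨⟨x, hM.eq_zero hJ fun j hj => ?_⟩, fun j => Subtype.ext (hx j)⟩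
  have := hx ⟨j, hj⟩
  rw [← map_smul, ← this]
  exact (φ ⟨j, hj⟩).2

/-- Maps into w-modules extend along inclusions with GV-torsion cokernel. -/
theorem IsWModule.exists_extend {F Y : Type u} [AddCommGroup F] [Module R F] [AddCommGroup Y]
    [Module R Y] (hF : IsWModule R F) (X : Submodule R Y)
    (hX : ∀ y : Y, ∃ J : Ideal R, IsGV J ∧ ∀ j ∈ J, j • y ∈ X) (f : X →ₗ[R] F) :
    ∃ h : Y →ₗ[R] F, ∀ x : X, h x = f x := by
  have hE := isInjectiveHull_toInjectiveHull R F
  set i := toInjectiveHull R F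
  -- Extend into the injective hull of `F`. The values stay in `F`: on a GV-ideal carrying `y` into
  -- `X`, `g y` acts like some `x ∈ F`, and the hull is GV-torsion-free.
  obtain ⟨g, hg⟩ := hE.injective.out X.subtype X.injective_subtype (i.comp f)
  have hr : ∀ y, g y ∈ LinearMap.range i := by
    intro y
    obtain ⟨J, hJ, hy⟩ := hX y
    obtain ⟨x, hx⟩ := (isWModule_iff.1 hF).2 J hJ
      (f.comp (((LinearMap.toSpanSingleton R Y y).comp J.subtype).codRestrict X
        fun j => hy j j.2))
    refine ⟨x, sub_eq_zero.1 ((hE.isGVTorsionFree hF.1).eq_zero hJ fun j hj => ?_)⟩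
    have h1 := hg ⟨j • y, hy j hj⟩
    have h2 := hx ⟨j, hj⟩
    rw [smul_sub, ← map_smul, ← map_smul, sub_eq_zero]
    refine Eq.trans ?_ h1.symm
    exact congrArg i h2.symm
  let e := LinearEquiv.ofInjective i hE.mono
  refine ⟨e.symm.toLinearMap.comp (g.codRestrict _ hr), fun x => ?_⟩
  rw [LinearMap.comp_apply, LinearEquiv.coe_coe, LinearEquiv.symm_apply_eq]
  exact Subtype.ext (hg x)

end GVBasics

/-! ### `Ext` through the presentation `ker p → P → M`. -/

section ExtSequence

variable {R : Type u} [CommRing R] {P M : Type u} [AddCommGroup P] [Module R P]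
  [AddCommGroup M] [Module R M]

/-- The complex `ker p → P → M`. -/
abbrev kerComplex (p : P →ₗ[R] M) : ShortComplex (ModuleCat.{u} R) where
  X₁ := ModuleCat.of R (LinearMap.ker p)
  X₂ := ModuleCat.of R P
  X₃ := ModuleCat.of R M
  f := ModuleCat.ofHom (LinearMap.ker p).subtype
  g := ModuleCat.ofHom p
  zero := by ext x; exact x.2

theorem kerComplex_shortExact {p : P →ₗ[R] M} (hp : Function.Surjective p) :
    (kerComplex p).ShortExact where
  exact := (ShortComplex.ShortExact.moduleCat_exact_iff_function_exact _).mpr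
    fun x => ⟨fun h => ⟨⟨x, h⟩, rfl⟩, fun ⟨y, hy⟩ => hy ▸ y.2⟩
  mono_f := (ModuleCat.mono_iff_injective _).mpr (Submodule.injective_subtype _)
  epi_g := (ModuleCat.epi_iff_surjective _).mpr hp

/-- This is the long exact sequence of `Hom(-, N)`, in which `Ext¹(P, N)` vanishes. -/
theorem subsingleton_ext_one_iff [Module.Projective R P] {p : P →ₗ[R] M}
    (hp : Function.Surjective p) (N : Type u) [AddCommGroup N] [Module R N] :
    Subsingleton (ExtR R M N 1) ↔
      ∀ φ : LinearMap.ker p →ₗ[R] N, ∃ ψ : P →ₗ[R] N, ∀ x : LinearMap.ker p, ψ x = φ x := by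
  have hS := kerComplex_shortExact hp
  have : Projective (kerComplex p).X₂ := (IsProjective.iff_projective (R := R) P).1 inferInstance
  constructor
  · intro h φ
    obtain ⟨y, hy⟩ := Abelian.Ext.contravariant_sequence_exact₁ hS _
      (Abelian.Ext.mk₀ (ModuleCat.ofHom φ : (kerComplex p).X₁ ⟶ ModuleCat.of R N)) (n₁ := 1) rfl
      (h.elim _ _)
    obtain ⟨ψ, rfl⟩ := (Abelian.Ext.mk₀_bijective _ _).2 y
    rw [Abelian.Ext.mk₀_comp_mk₀] at hy
    have e := (Abelian.Ext.mk₀_bijective _ _).1 hy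
    exact ⟨ψ.hom, fun x => LinearMap.congr_fun (congrArg ModuleCat.Hom.hom e) x⟩
  · intro h
    refine subsingleton_of_forall_eq 0 fun e => ?_
    obtain ⟨y, rfl⟩ := Abelian.Ext.contravariant_sequence_exact₃ hS _ (n₁ := 1) e
      (Abelian.Ext.eq_zero_of_projective (P := (kerComplex p).X₂) _) (n₀ := 0) rfl
    obtain ⟨φ, rfl⟩ := (Abelian.Ext.mk₀_bijective _ _).2 y
    obtain ⟨ψ, hψ⟩ := h φ.hom
    have : φ = (kerComplex p).f ≫ ModuleCat.ofHom ψ := by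
      ext x
      exact (hψ x).symm
    rw [this, ← Abelian.Ext.mk₀_comp_mk₀, hS.extClass_comp_assoc]

/-- Dimension shifting. -/
theorem subsingleton_ext_succ [Module.Projective R P] {p : P →ₗ[R] M}
    (hp : Function.Surjective p) (N : Type u) [AddCommGroup N] [Module R N] {n : ℕ}
    (h : Subsingleton (ExtR R (LinearMap.ker p) N n)) : Subsingleton (ExtR R M N (n + 1)) := by
  have : Projective (kerComplex p).X₂ := (IsProjective.iff_projective (R := R) P).1 inferInstance
  refine subsingleton_of_forall_eq 0 fun e => ?_
  obtain ⟨y, rfl⟩ := Abelian.Ext.contravariant_sequence_exact₃ (kerComplex_shortExact hp) _ e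
    (Abelian.Ext.eq_zero_of_projective (P := (kerComplex p).X₂) _) (n₀ := n) (add_comm _ _)
  rw [h.elim y 0, Abelian.Ext.comp_zero]

/-- If multiplication by `d` on `M` factors through a projective module, then `d` kills
`Ext¹(M, N)`. -/
theorem smul_ext_eq_zero [Module.Projective R P] {p : P →ₗ[R] M} {h : M →ₗ[R] P} {d : R}
    (hd : ∀ x, p (h x) = d • x) {N : Type u} [AddCommGroup N] [Module R N]
    (e : ExtR R M N 1) : d • e = 0 := by
  have : Projective (ModuleCat.of R P) := (IsProjective.iff_projective (R := R) P).1 inferInstance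
  have h1 : ModuleCat.ofHom h ≫ ModuleCat.ofHom p = d • 𝟙 (ModuleCat.of R M) := by
    ext x
    exact hd x
  have h2 : d • e = (Abelian.Ext.mk₀ (d • 𝟙 (ModuleCat.of R M))).comp e (zero_add 1) := by
    rw [Abelian.Ext.mk₀_smul, Abelian.Ext.smul_comp, Abelian.Ext.mk₀_id_comp]
  rw [h2, ← h1, ← Abelian.Ext.mk₀_comp_mk₀, Abelian.Ext.comp_assoc_of_second_deg_zero,
    Abelian.Ext.eq_zero_of_projective ((Abelian.Ext.mk₀ (ModuleCat.ofHom p)).comp e (zero_add 1)),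
    Abelian.Ext.comp_zero]

/-- If `d` kills the class of the extension `ker p → P → M`, then multiplication by `d` on `M`
lifts along `p`. -/
theorem exists_ext_forall_smul_eq_zero {p : P →ₗ[R] M} (hp : Function.Surjective p) :
    ∃ e : ExtR R M (LinearMap.ker p) 1, ∀ d : R, d • e = 0 →
      ∃ h : M →ₗ[R] P, ∀ x, p (h x) = d • x := by
  have hS := kerComplex_shortExact hp
  refine ⟨hS.extClass, fun d hd => ?_⟩
  -- The obstruction to lifting `d • 𝟙` along `p` is `d` times the class of the extension.
  obtain ⟨y, hy⟩ := Abelian.Ext.covariant_sequence_exact₃ (ModuleCat.of R M) hS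
    (Abelian.Ext.mk₀ (d • 𝟙 (ModuleCat.of R M))) (n₁ := 1) rfl (by
      rw [Abelian.Ext.mk₀_smul, Abelian.Ext.smul_comp, Abelian.Ext.mk₀_id_comp]
      exact hd)
  obtain ⟨h, rfl⟩ := (Abelian.Ext.mk₀_bijective _ _).2 y
  rw [Abelian.Ext.mk₀_comp_mk₀] at hy
  have e := (Abelian.Ext.mk₀_bijective _ _).1 hy
  exact ⟨h.hom, fun x => LinearMap.congr_fun (congrArg ModuleCat.Hom.hom e) x⟩

end ExtSequence

/-! ### Base change to the w-Nagata ring. -/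

section BaseChange

open TensorProduct

variable {R : Type u} [CommRing R]

/-- A polynomial with content `J` has its coefficients in `J`, so it lies in the extension of `J` to
`R[x]`; it also belongs to `S_w`. -/
theorem IsGV.map_eq_top {J : Ideal R} (hJ : IsGV J) :
    J.map (algebraMap R (WNagata R)) = ⊤ := by
  obtain ⟨f, hf⟩ := exists_contentIdeal_eq hJ.1
  have hfS : f ∈ nagataSet R := show IsGV f.contentIdeal from hf ▸ hJ
  refine Ideal.eq_top_of_isUnit_mem _ ?_
    (IsLocalization.map_units (WNagata R) (⟨f, hfS⟩ : nagataSet R))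
  rw [IsScalarTower.algebraMap_eq R R[X] (WNagata R), ← Ideal.map_map]
  refine Ideal.mem_map_of_mem _ ?_
  refine Ideal.mem_map_C_iff.2 fun n => ?_
  rw [← hf]
  exact coeff_mem_contentIdeal f n

/-- Membership in an `R{x}`-submodule can be tested after multiplication by a GV-ideal. -/
theorem IsGV.mem_of_smul_mem {J : Ideal R} (hJ : IsGV J) {X : Type*} [AddCommMonoid X]
    [Module (WNagata R) X] (Y : Submodule (WNagata R) X) (y : X)
    (h : ∀ j ∈ J, algebraMap R (WNagata R) j • y ∈ Y) : y ∈ Y := by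
  have : J.map (algebraMap R (WNagata R)) ≤
      Submodule.comap (LinearMap.toSpanSingleton (WNagata R) X y) Y :=
    Ideal.map_le_iff_le_comap.2 fun j hj => h j hj
  rw [hJ.map_eq_top] at this
  simpa using this (Submodule.mem_top (x := 1))

theorem isGVTorsionFree_of_wNagata (N : Type*) [AddCommGroup N] [Module R N]
    [Module (WNagata R) N] [IsScalarTower R (WNagata R) N] : IsGVTorsionFree R N :=
  isGVTorsionFree_of fun J x hJ hx => by
    simpa using hJ.mem_of_smul_mem (⊥ : Submodule (WNagata R) N) x fun j hj => by
      simpa using hx j hj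

theorem one_tmul_eq_zero {M : Type*} [AddCommGroup M] [Module R M] {x : M}
    (hx : x ∈ torGV R M) : (1 : WNagata R) ⊗ₜ[R] x = 0 := by
  obtain ⟨J, hJ, h⟩ := hx
  refine (isGVTorsionFree_of_wNagata (WNagata R ⊗[R] M)).eq_zero hJ fun j hj => ?_
  rw [← TensorProduct.tmul_smul, h j hj, TensorProduct.tmul_zero]

instance : Module.Flat R (WNagata R) :=
  have : Module.Flat R[X] (WNagata R) := IsLocalization.flat _ (nagataSet R)
  Module.Flat.trans R R[X] (WNagata R)

/-- `(R{x}) ⊗ M ≅ M{x}`. -/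
noncomputable def tensorEquivWNagataModule (M : Type u) [AddCommGroup M] [Module R M] :
    WNagata R ⊗[R] M ≃ₗ[WNagata R] WNagataModule R M :=
  (AlgebraTensorModule.cancelBaseChange R R[X] (WNagata R) (WNagata R) M).symm ≪≫ₗ
    (AlgebraTensorModule.congr (LinearEquiv.refl _ _)
      (PolynomialModule.polynomialTensorProductLEquivPolynomialModule R M)) ≪≫ₗ
    (IsLocalizedModule.isBaseChange (nagataSet R) (WNagata R)
      (LocalizedModule.mkLinearMap (nagataSet R) (PolynomialModule R M))).equiv

/-- A map with GV-torsion cokernel becomes surjective over `R{x}`. -/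
theorem baseChange_surjective {M N : Type*} [AddCommGroup M] [Module R M] [AddCommGroup N]
    [Module R N] (f : M →ₗ[R] N)
    (hf : ∀ y : N, ∃ J : Ideal R, IsGV J ∧ ∀ j ∈ J, j • y ∈ LinearMap.range f) :
    Function.Surjective (f.baseChange (WNagata R)) := by
  rw [← LinearMap.range_eq_top, eq_top_iff]
  rintro z -
  induction z with
  | zero => exact zero_mem _
  | add x y hx hy => exact add_mem hx hy
  | tmul a y =>
    obtain ⟨J, hJ, h⟩ := hf y
    refine hJ.mem_of_smul_mem (LinearMap.range (f.baseChange (WNagata R))) _ fun j hj => ?_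
    obtain ⟨x, hx⟩ := h j hj
    exact ⟨a ⊗ₜ x, by simp [hx, TensorProduct.tmul_smul]⟩

/-- A map with GV-torsion kernel becomes injective over `R{x}`. -/
theorem baseChange_injective {M N : Type*} [AddCommGroup M] [Module R M] [AddCommGroup N]
    [Module R N] (f : M →ₗ[R] N) (hf : ∀ x, f x = 0 → x ∈ torGV R M) :
    Function.Injective (f.baseChange (WNagata R)) := by
  refine (injective_iff_map_eq_zero _).2 fun z hz => ?_
  -- By flatness the kernel comes from `R{x} ⊗ ker f`, whose elements map to zero because `ker f` is
  -- GV-torsion.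
  obtain ⟨w, rfl⟩ := (Module.Flat.lTensor_exact (WNagata R)
    (LinearMap.exact_subtype_ker_map f) z).1 hz
  have h0 : LinearMap.lTensor (WNagata R) (LinearMap.ker f).subtype = 0 :=
    TensorProduct.ext' fun a y => by
      have := congrArg (fun z => a • z) (one_tmul_eq_zero (hf y y.2))
      simpa [TensorProduct.smul_tmul'] using this
  rw [h0, LinearMap.zero_apply]

/-- `M → L(M)` becomes an isomorphism over `R{x}`. -/
noncomputable def tensorEquivLMod (M : Type u) [AddCommGroup M] [Module R M] :
    WNagata R ⊗[R] M ≃ₗ[WNagata R] WNagata R ⊗[R] LMod R M :=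
  LinearEquiv.ofBijective ((toLMod R M).baseChange (WNagata R))
    ⟨baseChange_injective _ fun x hx => (toLMod_eq_zero_iff x).1 hx,
      baseChange_surjective _ exists_smul_mem_range_toLMod⟩

/-- By McCoy's theorem a zero divisor in `R[x]` is killed by a nonzero constant, but no nonzero
constant annihilates a GV-ideal. -/
theorem nagataSet_le_nonZeroDivisors : nagataSet R ≤ nonZeroDivisors R[X] := by
  intro f hf
  refine Polynomial.mem_nonZeroDivisors_iff.2 fun a ha => ?_
  refine IsGV.eq_zero (J := f.contentIdeal) hf fun j hj => ?_
  have : f.contentIdeal ≤ LinearMap.ker (LinearMap.mulLeft R a) := by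
    rw [contentIdeal_def, Ideal.span_le]
    intro c hc
    obtain ⟨k, -, rfl⟩ := mem_coeffs_iff.1 hc
    simpa using congrArg (fun p => p.coeff k) ha
  exact this hj

/-- An identity over `R{x}` between combinations of elements of `M` comes from one over `R[x]`. -/
theorem exists_sum_coeff_smul_eq {M : Type u} [AddCommGroup M] [Module R M] {ι : Type*}
    [Fintype ι] (p p' : ι → R[X]) (b : ι → M)
    (h : ∑ i, algebraMap R[X] (WNagata R) (p i) ⊗ₜ[R] b i =
      ∑ i, algebraMap R[X] (WNagata R) (p' i) ⊗ₜ[R] b i) :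
    ∃ g ∈ nagataSet R, ∀ q : R[X], g ∣ q → ∀ k,
      ∑ i, (q * p i).coeff k • b i = ∑ i, (q * p' i).coeff k • b i := by
  let e := AlgebraTensorModule.cancelBaseChange R R[X] (WNagata R) (WNagata R) M
  have hloc : IsLocalizedModule (nagataSet R)
      (TensorProduct.mk R[X] (WNagata R) (R[X] ⊗[R] M) 1) :=
    (isLocalizedModule_iff_isBaseChange (nagataSet R) (WNagata R) _).2
      (TensorProduct.isBaseChange R[X] (R[X] ⊗[R] M) (WNagata R))
  have he : ∀ p : ι → R[X],
      e (TensorProduct.mk R[X] (WNagata R) (R[X] ⊗[R] M) 1 (∑ i, p i ⊗ₜ[R] b i)) =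
        ∑ i, algebraMap R[X] (WNagata R) (p i) ⊗ₜ[R] b i := fun p => by
    rw [map_sum, map_sum]
    refine Finset.sum_congr rfl fun i _ => ?_
    simp [e, Algebra.smul_def]
  obtain ⟨g, hg⟩ := (IsLocalizedModule.eq_iff_exists (nagataSet R)
    (TensorProduct.mk R[X] (WNagata R) (R[X] ⊗[R] M) 1)).1
    (e.injective ((he p).trans (h.trans (he p').symm)))
  refine ⟨g, g.2, ?_⟩
  -- Allowing all multiples of `g` lets several identities share one multiplier later.
  rintro _ ⟨q, rfl⟩ k
  have h1 : ∑ i, (g * q * p i : R[X]) ⊗ₜ[R] b i = ∑ i, (g * q * p' i : R[X]) ⊗ₜ[R] b i := by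
    have := congrArg (fun z => q • z) hg
    simpa [Submonoid.smul_def, Finset.smul_sum, TensorProduct.smul_tmul', ← mul_assoc,
      mul_comm q (g : R[X])] using this
  have := congrArg (fun z => TensorProduct.lid R M (LinearMap.rTensor M (lcoeff R k) z)) h1
  simpa using this

end BaseChange

/-! ### Projectivity over `R{x}` and the implications. -/

open TensorProduct

variable {R : Type u} [CommRing R]

/-- `w`-projective modules become projective over the `w`-Nagata ring. -/
theorem IsWProjective.projective_tensor {M : Type u} [AddCommGroup M] [Module R M]
    (hM : IsWProjective R M) : Module.Projective (WNagata R) (WNagata R ⊗[R] M) := by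
  let L := LMod R M
  let p : (L →₀ R) →ₗ[R] L := Finsupp.linearCombination R id
  have hp : Function.Surjective p := Finsupp.linearCombination_id_surjective R L
  have hlift : ∃ s, p.baseChange (WNagata R) ∘ₗ s = LinearMap.id := by
    have hT := hM (LinearMap.ker p) inferInstance
      ((isWModule_finsupp L).ker (isGVTorsionFree_LMod M) p)
    obtain ⟨J, hJ, h⟩ : ∃ J : Ideal R, IsGV J ∧
        ∀ j ∈ J, ∃ h : L →ₗ[R] (L →₀ R), ∀ x, p (h x) = j • x := by
      obtain ⟨e, he⟩ := exists_ext_forall_smul_eq_zero hp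
      obtain ⟨J, hJ, h⟩ : e ∈ torGV R (ExtR R L (LinearMap.ker p) 1) :=
        hT.symm ▸ Submodule.mem_top
      exact ⟨J, hJ, fun j hj => he j (h j hj)⟩
    -- The endomorphisms of `R{x} ⊗ L` that factor through the base change of `p` form an
    -- `R{x}`-submodule. It contains `j • id` for all `j ∈ J`, hence `id`.
    refine hJ.mem_of_smul_mem
      (LinearMap.range ((p.baseChange (WNagata R)).compRight (WNagata R)
        (M₂ := WNagata R ⊗[R] L))) LinearMap.id fun j hj => ?_
    obtain ⟨h, hh⟩ := h j hj
    refine ⟨h.baseChange (WNagata R), ?_⟩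
    ext x
    simp [hh, TensorProduct.tmul_smul]
  obtain ⟨s, hs⟩ := hlift
  have : Module.Projective (WNagata R) (WNagata R ⊗[R] L) := Module.Projective.of_split s _ hs
  exact Module.Projective.of_equiv (tensorEquivLMod M).symm

/-- For flat `A`, projectivity of `A ⊗ M` amounts to a retraction of a base changed syzygy. -/
theorem projective_tensor_iff_exists_retraction (A : Type*) [CommRing A] [Algebra R A]
    [Module.Flat R A] {P M : Type*} [AddCommGroup P] [Module R P] [Module.Projective R P]
    [AddCommGroup M] [Module R M] {p : P →ₗ[R] M} (hp : Function.Surjective p) :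
    Module.Projective A (A ⊗[R] M) ↔ ∃ r : A ⊗[R] P →ₗ[A] A ⊗[R] LinearMap.ker p,
      r ∘ₗ (LinearMap.ker p).subtype.baseChange A = LinearMap.id := by
  have hinj : Function.Injective ((LinearMap.ker p).subtype.baseChange A) :=
    Module.Flat.lTensor_preserves_injective_linearMap _ (Submodule.injective_subtype _)
  have hex : Function.Exact ((LinearMap.ker p).subtype.baseChange A) (p.baseChange A) :=
    Module.Flat.lTensor_exact A (LinearMap.exact_subtype_ker_map p)
  have hsurj : Function.Surjective (p.baseChange A) := LinearMap.lTensor_surjective _ hp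
  refine Iff.trans ?_ ((hex.split_tfae hinj hsurj).out 0 1)
  exact ⟨fun _ => Module.projective_lifting_property _ LinearMap.id hsurj,
    fun ⟨s, hs⟩ => Module.Projective.of_split s _ hs⟩

/-- By adjunction a map `ker p → N` becomes `R{x}`-linear on `R{x} ⊗ ker p`; composing with the
retraction extends it. -/
theorem subsingleton_ext_one_of_projective_tensor {M : Type u} [AddCommGroup M] [Module R M]
    (hM : Module.Projective (WNagata R) (WNagata R ⊗[R] M)) (N : Type u) [AddCommGroup N]
    [Module R N] [Module (WNagata R) N] [IsScalarTower R (WNagata R) N] :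
    Subsingleton (ExtR R M N 1) := by
  have hp : Function.Surjective (Finsupp.linearCombination R (id : M → M)) :=
    Finsupp.linearCombination_id_surjective R M
  refine (subsingleton_ext_one_iff hp N).2 fun φ => ?_
  obtain ⟨r, hr⟩ := (projective_tensor_iff_exists_retraction _ hp).1 hM
  let Φ := (LinearMap.liftBaseChangeEquiv (WNagata R)) φ
  refine ⟨((Φ ∘ₗ r).restrictScalars R) ∘ₗ TensorProduct.mk R (WNagata R) _ 1, fun x => ?_⟩
  have := LinearMap.congr_fun hr (1 ⊗ₜ x)
  simp only [LinearMap.comp_apply, LinearMap.baseChange_tmul, Submodule.subtype_apply,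
    LinearMap.id_apply] at this
  simp [this, Φ]

/-- The hypothesis passes to syzygies, since `R{x} ⊗ ker p` is a retract of a free module; dimension
shifting then applies. -/
theorem subsingleton_ext_of_projective_tensor {M : Type u} [AddCommGroup M] [Module R M]
    (hM : Module.Projective (WNagata R) (WNagata R ⊗[R] M)) (N : Type u) [AddCommGroup N]
    [Module R N] [Module (WNagata R) N] [IsScalarTower R (WNagata R) N] (k : ℕ) :
    Subsingleton (ExtR R M N (k + 1)) := by
  induction k generalizing M with
  | zero => exact subsingleton_ext_one_of_projective_tensor hM N
  | succ k ih =>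
    have hp : Function.Surjective (Finsupp.linearCombination R (id : M → M)) :=
      Finsupp.linearCombination_id_surjective R M
    obtain ⟨r, hr⟩ := (projective_tensor_iff_exists_retraction _ hp).1 hM
    exact subsingleton_ext_succ hp N (ih (Module.Projective.of_split _ r hr))

theorem isPwDagger_of_wNagata (N : Type u) [AddCommGroup N]
    [Module R N] [Module (WNagata R) N] [IsScalarTower R (WNagata R) N] : IsPwDagger R N := by
  refine ⟨isGVTorsionFree_of_wNagata N, fun M _ _ hM k hk => ?_⟩
  obtain ⟨k, rfl⟩ := Nat.exists_eq_add_of_le' hk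
  exact subsingleton_ext_of_projective_tensor hM.projective_tensor N k

theorem projective_tensor_of_subsingleton_ext {M : Type u} [AddCommGroup M] [Module R M]
    (h : ∀ (N : Type u) [AddCommGroup N] [Module R N] [Module (WNagata R) N]
      [IsScalarTower R (WNagata R) N], Subsingleton (ExtR R M N 1)) :
    Module.Projective (WNagata R) (WNagata R ⊗[R] M) := by
  let p := Finsupp.linearCombination R (id : M → M)
  have hp : Function.Surjective p := Finsupp.linearCombination_id_surjective R M
  -- Test on the base changed syzygy: an extension of `y ↦ 1 ⊗ y` to the free module is, by
  -- adjunction, the retraction sought.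
  obtain ⟨ψ, hψ⟩ := (subsingleton_ext_one_iff hp _).1 (h (WNagata R ⊗[R] LinearMap.ker p))
    (TensorProduct.mk R (WNagata R) _ 1)
  let r := LinearMap.liftBaseChangeEquiv (WNagata R) ψ
  refine (projective_tensor_iff_exists_retraction _ hp).2 ⟨r, ?_⟩
  ext x
  simpa [r] using hψ x

/-- If `M` is of finite type and `R{x} ⊗ M` is projective, then multiplication by the elements of
some GV-ideal on `L(M)` factors through a finite free module. -/
theorem IsFiniteType.exists_factor {M : Type u} [AddCommGroup M] [Module R M]
    (hM : IsFiniteType R M) (hP : Module.Projective (WNagata R) (WNagata R ⊗[R] M)) :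
    ∃ (n : ℕ) (p : (Fin n → R) →ₗ[R] LMod R M) (f : R[X]), f ∈ nagataSet R ∧
      (∀ y : LMod R M, ∃ J : Ideal R, IsGV J ∧ ∀ j ∈ J, j • y ∈ LinearMap.range p) ∧
      ∀ k, ∃ h : (Fin n → R) →ₗ[R] (Fin n → R),
        (∀ x, p x = 0 → h x = 0) ∧ ∀ x, p (h x) = f.coeff k • p x := by
  classical
  obtain ⟨n, φ, hφ⟩ := hM
  let b : Fin n → M := fun i => φ (Pi.single i 1)
  have hφb : ∀ r, φ r = ∑ i, r i • b i := fun r => by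
    conv_lhs => rw [pi_eq_sum_univ' r]
    simp [b]
  let q : (Fin n → WNagata R) →ₗ[WNagata R] WNagata R ⊗[R] M :=
    Fintype.linearCombination (WNagata R) fun i => 1 ⊗ₜ b i
  have hqa : ∀ a, q a = ∑ i, a i ⊗ₜ b i := fun a => by
    simp [q, Fintype.linearCombination_apply, TensorProduct.smul_tmul']
  have hq : Function.Surjective q := by
    rw [← LinearMap.range_eq_top, eq_top_iff]
    rintro z -
    induction z with
    | zero => exact zero_mem _
    | add x y hx hy => exact add_mem hx hy
    | tmul a y =>
      obtain ⟨J, hJ, h⟩ := hφ.exists_isGV y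
      refine hJ.mem_of_smul_mem (LinearMap.range q) _ fun j hj => ?_
      obtain ⟨r, hr⟩ := h j hj
      refine ⟨fun i => r i • a, ?_⟩
      rw [hqa, algebraMap_smul, ← TensorProduct.tmul_smul, ← hr, hφb, TensorProduct.tmul_sum]
      simp [TensorProduct.smul_tmul]
  obtain ⟨s, hs⟩ := Module.projective_lifting_property q LinearMap.id hq
  -- Clear the denominators of the matrix of `s`; then `q ∘ s = id` expresses `g ⊗ b j` through the
  -- polynomial entries `c (j, i)`.
  obtain ⟨g, hg⟩ := IsLocalization.exist_integer_multiples_of_finite (nagataSet R)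
    fun ji : Fin n × Fin n => s (1 ⊗ₜ b ji.1) ji.2
  choose c hc using hg
  have key : ∀ j, ∑ i, algebraMap R[X] (WNagata R) (c (j, i)) ⊗ₜ[R] b i =
      ∑ i, algebraMap R[X] (WNagata R) (if i = j then (g : R[X]) else 0) ⊗ₜ[R] b i := by
    intro j
    have h1 := LinearMap.congr_fun hs (1 ⊗ₜ b j)
    simp only [LinearMap.comp_apply, LinearMap.id_apply, hqa] at h1
    have h2 := congrArg (fun z => algebraMap R[X] (WNagata R) g • z) h1
    simp only [Finset.smul_sum, TensorProduct.smul_tmul', smul_eq_mul, mul_one] at h2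
    simp only [hc, Algebra.smul_def]
    rw [h2, Finset.sum_eq_single j (by intro i _ hi; simp [hi]) (by simp), if_pos rfl]
  choose g' hg' hg'b using fun j => exists_sum_coeff_smul_eq _ _ b (key j)
  let G := ∏ j, g' j
  have hG : G ∈ nagataSet R := Submonoid.prod_mem _ fun j _ => hg' j
  refine ⟨n, toLMod R M ∘ₗ φ, G * g, mul_mem hG g.2, fun y => ?_, fun k => ?_⟩
  · obtain ⟨J, hJ, h⟩ := exists_smul_mem_range_toLMod y
    refine hJ.exists_smul_mem _ y fun j hj => ?_
    obtain ⟨m, hm⟩ := h j hj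
    obtain ⟨I, hI, hIm⟩ := hφ.exists_isGV m
    refine ⟨I, hI, fun i hi => ?_⟩
    obtain ⟨x, hx⟩ := hIm i hi
    exact ⟨x, by rw [LinearMap.comp_apply, hx, map_smul, hm]⟩
  -- The matrix of `h` consists of the coefficients of degree `k` in `G * c (j, i)`.
  let h : (Fin n → R) →ₗ[R] (Fin n → R) :=
    LinearMap.pi fun i => Fintype.linearCombination R fun j => (G * c (j, i)).coeff k
  have hh : ∀ x i, h x i = ∑ j, x j * (G * c (j, i)).coeff k := fun x i => by
    simp [h, Fintype.linearCombination_apply]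
  refine ⟨h, fun x hx => ?_, fun x => ?_⟩
  -- If `p x = 0`, then `φ x` is GV-torsion and dies over `R{x}`. Applying `s` gives a relation
  -- among the `c (j, i)` that already holds in `R[x]`, since `S_w` has no zero divisors.
  · have h0 : (1 : WNagata R) ⊗ₜ[R] φ x = 0 := one_tmul_eq_zero ((toLMod_eq_zero_iff _).1 hx)
    ext i
    have h1 : ∑ j, x j • c (j, i) = 0 := by
      apply IsLocalization.injective (WNagata R) (nagataSet_le_nonZeroDivisors (R := R))
      have h2 := congrFun (congrArg s h0) i
      rw [hφb, TensorProduct.tmul_sum, map_sum, map_zero, Finset.sum_apply] at h2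
      have h3 := congrArg (fun z => (g : R[X]) • z) h2
      simp only [Finset.smul_sum, Pi.zero_apply, smul_zero] at h3
      rw [map_zero, map_sum, ← h3]
      refine Finset.sum_congr rfl fun j _ => ?_
      rw [TensorProduct.tmul_smul, LinearMap.map_smul_of_tower, Pi.smul_apply, smul_comm, ← hc (j, i),
        ← IsScalarTower.coe_toAlgHom' R R[X] (WNagata R), map_smul]
    have h2 := congrArg (fun q => (G * q).coeff k) h1
    simpa [hh, Finset.mul_sum] using h2
  · have h1 : ∀ j, ∑ i, (G * c (j, i)).coeff k • b i = (G * g).coeff k • b j := fun j => by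
      have := hg'b j G (Finset.dvd_prod_of_mem g' (Finset.mem_univ j)) k
      rw [this, Finset.sum_eq_single j (by intro i _ hi; simp [hi]) (by simp), if_pos rfl]
    rw [LinearMap.comp_apply, LinearMap.comp_apply, ← map_smul]
    congr 1
    simp only [hφb, hh, Finset.sum_smul, Finset.smul_sum]
    rw [Finset.sum_comm]
    refine Finset.sum_congr rfl fun j _ => ?_
    rw [smul_comm, ← h1, Finset.smul_sum]
    simp only [mul_smul]

theorem IsFiniteType.isWProjective {M : Type u} [AddCommGroup M] [Module R M]
    (hM : IsFiniteType R M) (hP : Module.Projective (WNagata R) (WNagata R ⊗[R] M)) :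
    IsWProjective R M := by
  intro N _ _ _ _
  obtain ⟨n, p, f, hf, hp, h⟩ := hM.exists_factor hP
  refine eq_top_iff.2 fun e _ => ⟨f.contentIdeal, hf, fun j hj => ?_⟩
  have hle : f.contentIdeal ≤ LinearMap.ker (LinearMap.toSpanSingleton R _ e) := by
    rw [contentIdeal_def, Ideal.span_le]
    intro c hc
    obtain ⟨k, -, rfl⟩ := mem_coeffs_iff.1 hc
    obtain ⟨h, h0, hh⟩ := h k
    -- Since `h` kills `ker p`, it descends to the range of `p`, and then extends to `L(M)` because
    -- `R^n` is a w-module.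
    obtain ⟨h', hh'⟩ := (isWModule_fin n).exists_extend (LinearMap.range p) hp
      (((LinearMap.ker p).liftQ h fun x hx => h0 x hx) ∘ₗ
        p.quotKerEquivRange.symm.toLinearMap)
    have hx : ∀ x, h' (p x) = h x := fun x =>
      (hh' ⟨p x, x, rfl⟩).trans
        (congrArg ((LinearMap.ker p).liftQ h fun x hx => h0 x hx)
          (p.quotKerEquivRange_symm_apply_image x ⟨x, rfl⟩))
    change f.coeff k • e = 0
    refine smul_ext_eq_zero (h := h') (p := p) (fun y => ?_) e
    -- The two maps agree on the range of `p`, hence everywhere, as its cokernel is GV-torsion and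
    -- `L(M)` is GV-torsion-free.
    obtain ⟨J, hJ, hy⟩ := hp y
    refine sub_eq_zero.1 ((isGVTorsionFree_LMod M).eq_zero hJ fun j hj => ?_)
    obtain ⟨x, hxy⟩ := hy j hj
    rw [smul_sub, ← map_smul, ← map_smul, smul_comm, ← hxy, hx, hh, sub_self]
  exact hle hj

end WTheory

theorem mainTheorem6 (R : Type u) [CommRing R] (M : Type u) [AddCommGroup M] [Module R M]
    (hM : WTheory.IsFiniteType R M) :
    List.TFAE [
      WTheory.IsWProjective R M,
      ∀ (B : Type u) [AddCommGroup B] [Module R B], WTheory.IsPwDagger R B →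
        Subsingleton (WTheory.ExtR R M B 1),
      ∀ (N : Type u) [AddCommGroup N] [Module R N] [Module (WTheory.WNagata R) N]
        [IsScalarTower R (WTheory.WNagata R) N], Subsingleton (WTheory.ExtR R M N 1),
      Module.Projective (WTheory.WNagata R) (WTheory.WNagataModule R M)] := by
  tfae_have 1 → 2 := fun h B _ _ hB => hB.2 M h 1 le_rfl
  tfae_have 2 → 3 := fun h N _ _ _ _ => h N (WTheory.isPwDagger_of_wNagata N)
  tfae_have 3 → 4 := fun h =>
    have := WTheory.projective_tensor_of_subsingleton_ext h
    Module.Projective.of_equiv (WTheory.tensorEquivWNagataModule M)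
  tfae_have 4 → 1 := fun _ =>
    hM.isWProjective (Module.Projective.of_equiv (WTheory.tensorEquivWNagataModule M).symm)
  tfae_finish
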